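/- All rings are associative with identity. Let $n\ge 1$ and let $A=\sigma(R)\langle x_1,\dots,x_n\rangle$ be a skew PBW extension of a ring $R$; that is, $R$ is a subring of $A$ with the same identity, $x_1,\dots,x_n\in A$, and: (a) $A$ is a free left $R$-module with basis the standard monomials $x_1^{\alpha_1}\cdots x_n^{\alpha_n}$, $\alpha\in\mathbb N^n$; (b) for every $i$ and every $0\ne r\in R$ there is $0\neq c_{i,r}\in R$ with $x_ir-c_{i,r}x_i\in R$; (c) for all $i,j$ there is $0\ne d_{i,j}\in R$ with $x_jx_i-d_{i,j}x_ix_j\in R+Rx_1+\cdots+Rx_n$. Let $\sigma_i,\delta_i:R\to R$ be the maps (uniquely) determined by $x_ir=\sigma_i(r)x_i+\delta_i(r)$ for all $r\in R$, and for $\alpha\in\mathbb N^n$ write $\sigma^\alpha=\sigma_1^{\alpha_1}\circ\cdots\circ\sigma_n^{\alpha_n}$ and $\delta^\alpha=\delta_1^{\alpha_1}\circ\cdots\circ\delta_n^{\alpha_n}$. Suppose that $R$ is $(\Sigma,\Delta)$-compatible, i.e. for all $a,b\in R$ and $\alpha\in\mathbb N^n$ one has $a\sigma^\alpha(b)=0$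 if and only if $ab=0$, and $ab=0$ implies $a\delta^\alpha(b)=0$; that $R$ is 2-primal, i.e. the intersection of all prime (two-sided) ideals of $R$ is the set of nilpotent elements of $R$; and that $R$ has exactly two minimal prime ideals. Then \[ \operatorname{diam}(\Gamma_N(A))=2 . \] Here the nilpotent graph $\Gamma_N(A)$ has as vertices the non-zero elements $a\in A$ for which there is $0\ne b\in A$ with $ab$ nilpotent, two distinct vertices $a,b$ are adjacent if and only if $ab$ is nilpotent, and $\operatorname{diam}$ is the supremum in $\mathbb N\cup\{\infty\}$ of the distances between vertices. -/

import Mathlib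

namespace SkewPBW

/-! ### Prime ideals, prime radical and 2-primal rings (noncommutative) -/

section Primes

variable (S : Type*) [Ring S]

/-- A two-sided ideal `P` of `S` is prime if it is proper and `a S b ⊆ P` implies `a ∈ P` or
`b ∈ P`. -/
structure IsPrimeIdeal {S : Type*} [Ring S] (P : TwoSidedIdeal S) : Prop where
  ne_top : P ≠ ⊤
  mem_or_mem : ∀ a b : S, (∀ s : S, a * s * b ∈ P) → a ∈ P ∨ b ∈ P

/-- The set of minimal prime ideals of `S`. -/
def minimalPrimeIdeals : Set (TwoSidedIdeal S) :=
  {P | Minimal IsPrimeIdeal P}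

/-- The prime radical of `S`: the intersection of all prime ideals. -/
def primeRadical : TwoSidedIdeal S :=
  sInf {P | IsPrimeIdeal P}

/-- `S` is 2-primal if its prime radical is the set of all nilpotent elements. -/
def IsTwoPrimal : Prop :=
  (primeRadical S : Set S) = {a | IsNilpotent a}

end Primes

/-! ### The nilpotent graph -/

section Graph

variable (S : Type*) [Ring S]

/-- The set `Z_N(S)` of the `a ∈ S` such that `a * b` is nilpotent for some non-zero `b ∈ S`. -/
def nilZeroDivisors : Set S :=
  {a | ∃ b : S, b ≠ 0 ∧ IsNilpotent (a * b)}

theorem isNilpotent_mul_swap {S : Type*} [Ring S] {a b : S} (h : IsNilpotent (a * b)) :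
    IsNilpotent (b * a) := by
  obtain ⟨k, hk⟩ := h
  refine ⟨k + 1, ?_⟩
  rw [pow_succ, ← mul_assoc, mul_pow_mul, hk]
  simp

/-- The nilpotent graph of `S`: its vertices are the non-zero elements of `Z_N(S)`, and distinct
vertices `a`, `b` are adjacent if and only if `a * b` is nilpotent. -/
def nilpotentGraph : SimpleGraph {a : S // a ∈ nilZeroDivisors S ∧ a ≠ 0} where
  Adj a b := a ≠ b ∧ IsNilpotent (a.1 * b.1)
  symm := ⟨fun _ _ h => ⟨h.1.symm, isNilpotent_mul_swap h.2⟩⟩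
  loopless := ⟨fun _ h => h.1 rfl⟩

end Graph

/-! ### Skew PBW extensions -/

section Extension

variable {A : Type*} [Ring A] {n : ℕ}

/-- The standard monomial `x_1 ^ α_1 ⋯ x_n ^ α_n`, the factors in this order. -/
def monomial (x : Fin n → A) (α : Fin n → ℕ) : A :=
  ((List.finRange n).map fun i => x i ^ α i).prod

/-- `A` is a skew PBW extension of its subring `R` (which has the same identity) in the
elements `x_1, …, x_n`. -/
structure IsSkewPBW (R : Subring A) (x : Fin n → A) : Prop where
  /-- The standard monomials are left linearly independent over `R`. -/
  linearIndependent : LinearIndependent R (monomial x)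
  /-- The standard monomials generate `A` as a left `R`-module. -/
  span_eq_top : Submodule.span R (Set.range (monomial x)) = ⊤
  exists_coeff : ∀ (i : Fin n) (r : R), r ≠ 0 → ∃ c : R, c ≠ 0 ∧ x i * r - c * x i ∈ R
  exists_comm : ∀ i j : Fin n, ∃ d : R, d ≠ 0 ∧ ∃ (r₀ : R) (r : Fin n → R),
    x j * x i - d * (x i * x j) = r₀ + ∑ k, (r k : A) * x k

theorem monomial_zero (x : Fin n → A) : monomial x 0 = 1 := by
  simp [monomial]

theorem monomial_single (x : Fin n → A) (i : Fin n) : monomial x (Pi.single i 1) = x i := by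
  unfold monomial
  rw [List.prod_map_eq_pow_single i]
  · simp [List.count_eq_one_of_mem (List.nodup_finRange n) (List.mem_finRange i)]
  · intro j hj _
    simp [hj]

namespace IsSkewPBW

variable {R : Subring A} {x : Fin n → A}

/-- The standard monomials as a basis of the left `R`-module `A`. -/
noncomputable def basis (h : IsSkewPBW R x) : Module.Basis (Fin n → ℕ) R A :=
  Module.Basis.mk h.linearIndependent h.span_eq_top.ge

/-- `σ_i r` is the coefficient of `x_i` in `x_i * r`. -/
noncomputable def sigma (h : IsSkewPBW R x) (i : Fin n) (r : R) : R :=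
  h.basis.repr (x i * r) (Pi.single i 1)

/-- `δ_i r` is the constant coefficient of `x_i * r`. -/
noncomputable def delta (h : IsSkewPBW R x) (i : Fin n) (r : R) : R :=
  h.basis.repr (x i * r) 0

theorem eq_sigma_and_eq_delta (h : IsSkewPBW R x) (i : Fin n) (r a b : R)
    (hr : x i * r = a * x i + b) : a = h.sigma i r ∧ b = h.delta i r := by
  have e : x i * r = a • h.basis (Pi.single i 1) + b • h.basis 0 := by
    simp [basis, monomial_zero, monomial_single, Subring.smul_def, hr]
  have hne : (Pi.single i 1 : Fin n → ℕ) ≠ 0 := by simp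
  constructor
  · simp [sigma, e]
  · simp [delta, e, hne]

/-- The relation that characterizes the pair `σ_i`, `δ_i`. -/
theorem mul_eq (h : IsSkewPBW R x) (i : Fin n) (r : R) :
    x i * r = h.sigma i r * x i + h.delta i r := by
  by_cases h0 : r = 0
  · simp [sigma, delta, h0]
  · obtain ⟨c, -, hc⟩ := h.exists_coeff i r h0
    have e : x i * r = c * x i + (⟨_, hc⟩ : R) := by simp
    obtain ⟨h1, h2⟩ := h.eq_sigma_and_eq_delta i r _ _ e
    rw [← h1, ← h2]
    exact e

end IsSkewPBW

/-! ### Compatibility -/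

/-- The composition `f_1 ^ α_1 ∘ ⋯ ∘ f_n ^ α_n` of iterates of the maps `f_i`. -/
def iterComp {S : Type*} (f : Fin n → S → S) (α : Fin n → ℕ) : S → S :=
  ((List.finRange n).map fun i => (f i)^[α i]).foldr (fun g k => g ∘ k) id

/-- `S` is `(Σ, Δ)`-compatible for the families `Σ = (σ_i)` and `Δ = (δ_i)` of self-maps. -/
structure IsCompatible {S : Type*} [Ring S] (σ δ : Fin n → S → S) : Prop where
  sigma_iff : ∀ (a b : S) (α : Fin n → ℕ), a * iterComp σ α b = 0 ↔ a * b = 0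
  delta_of : ∀ (a b : S) (β : Fin n → ℕ), a * b = 0 → a * iterComp δ β b = 0

end Extension

end SkewPBW

/-!
Let `P` and `Q` be the two minimal primes of `R`. As `R` is 2-primal, `P ∩ Q` is the set of
nilpotent elements, and for any `q ∈ Q \ P` one has `P = {a | a q is nilpotent}`. This description
shows at once that `P` is completely prime and, by compatibility, invariant under the `σ_i` and
`δ_i`; the same holds for `Q`. Comparing leading terms in the degree-lexicographic order, the
elements of `A` with all coefficients in `P` form a completely prime ideal `PA`, and likewise `QA`.
The elements of `PA ∩ QA` have nilpotent coefficients. These coefficients lie in every prime ideal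
`K` of `A`: the elements of `R` that make no more two-sided products vanish than some element
outside `K` form an n-system avoiding `0`, whereas a nilpotent element of `R` lies in the prime
radical of `R` and hence in no such n-system. So the nilpotent elements of `A` are those of
`PA ∩ QA`, and the distances in the nilpotent graph can be read off from the pair `PA`, `QA`.
-/

namespace SkewPBW

section PrimeExistence

variable {S : Type*} [Ring S]

/-- An m-system: the noncommutative analogue of a multiplicative set. The complement of a prime
ideal is one. -/
def IsMSystem (M : Set S) : Prop :=
  ∀ s ∈ M, ∀ t ∈ M, ∃ r, s * r * t ∈ M

/-- An n-system: the analogue of an m-system for semiprime ideals. -/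
def IsNSystem (N : Set S) : Prop :=
  ∀ a ∈ N, ∃ r, a * r * a ∈ N

/-- The two-sided ideal of the `t` with `a S t ⊆ P`. -/
def rightColon (P : TwoSidedIdeal S) (a : S) : TwoSidedIdeal S :=
  TwoSidedIdeal.mk' {t | ∀ r, a * r * t ∈ P}
    (fun r => by simp)
    (fun hx hy r => by simpa only [mul_add] using P.add_mem (hx r) (hy r))
    (fun hx r => by simpa only [mul_neg] using P.neg_mem (hx r))
    (fun {x _} hy r => by simpa only [mul_assoc] using hy (r * x))
    (fun {_ y} hx r => by simpa only [mul_assoc] using P.mul_mem_right _ y (hx r))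

/-- The two-sided ideal of the `s` with `s S b ⊆ P`. -/
def leftColon (P : TwoSidedIdeal S) (b : S) : TwoSidedIdeal S :=
  TwoSidedIdeal.mk' {s | ∀ r, s * r * b ∈ P}
    (fun r => by simp)
    (fun hx hy r => by simpa only [add_mul] using P.add_mem (hx r) (hy r))
    (fun hx r => by simpa only [neg_mul] using P.neg_mem (hx r))
    (fun {x _} hy r => by simpa only [mul_assoc] using P.mul_mem_left x _ (hy r))
    (fun {_ y} hx r => by simpa only [mul_assoc] using hx (y * r))

theorem mem_rightColon {P : TwoSidedIdeal S} {a t : S} :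
    t ∈ rightColon P a ↔ ∀ r, a * r * t ∈ P := by
  simp [rightColon, TwoSidedIdeal.mem_mk']

theorem mem_leftColon {P : TwoSidedIdeal S} {b s : S} :
    s ∈ leftColon P b ↔ ∀ r, s * r * b ∈ P := by
  simp [leftColon, TwoSidedIdeal.mem_mk']

theorem le_rightColon (P : TwoSidedIdeal S) (a : S) : P ≤ rightColon P a :=
  fun _ ht => mem_rightColon.2 fun _ => P.mul_mem_left _ _ ht

theorem le_leftColon (P : TwoSidedIdeal S) (b : S) : P ≤ leftColon P b :=
  fun _ hs => mem_leftColon.2 fun _ => P.mul_mem_right _ _ (P.mul_mem_right _ _ hs)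

theorem exists_twoSidedIdeal_mem_iff_of_isChain {c : Set (TwoSidedIdeal S)}
    (hc : IsChain (· ≤ ·) c) (hne : c.Nonempty) :
    ∃ U : TwoSidedIdeal S, ∀ t, t ∈ U ↔ ∃ I ∈ c, t ∈ I := by
  refine ⟨TwoSidedIdeal.mk' {t | ∃ I ∈ c, t ∈ I} ?_ ?_ ?_ ?_ ?_,
    fun t => TwoSidedIdeal.mem_mk' _ _ _ _ _ _ t⟩
  · exact hne.imp fun I hI => ⟨hI, I.zero_mem⟩
  · rintro s t ⟨I, hI, hs⟩ ⟨J, hJ, ht⟩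
    obtain hIJ | hJI := hc.total hI hJ
    · exact ⟨J, hJ, J.add_mem (hIJ hs) ht⟩
    · exact ⟨I, hI, I.add_mem hs (hJI ht)⟩
  · exact fun ⟨I, hI, ht⟩ => ⟨I, hI, I.neg_mem ht⟩
  · exact fun ⟨I, hI, ht⟩ => ⟨I, hI, I.mul_mem_left _ _ ht⟩
  · exact fun ⟨I, hI, ht⟩ => ⟨I, hI, I.mul_mem_right _ _ ht⟩

theorem exists_maximal_disjoint {M : Set S} (h0 : (0 : S) ∉ M) :
    ∃ P : TwoSidedIdeal S, Maximal (fun I : TwoSidedIdeal S => ∀ s ∈ M, s ∉ I) P := by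
  obtain ⟨P, -, hP⟩ := zorn_le_nonempty₀ {I : TwoSidedIdeal S | ∀ s ∈ M, s ∉ I}
    (fun c hcM hc J hJ => by
      obtain ⟨U, hU⟩ := exists_twoSidedIdeal_mem_iff_of_isChain hc ⟨J, hJ⟩
      refine ⟨U, fun s hs hsU => ?_, fun I hI t ht => (hU t).2 ⟨I, hI, ht⟩⟩
      obtain ⟨I, hI, hsI⟩ := (hU s).1 hsU
      exact hcM hI s hs hsI)
    ⊥ (fun s hs hs0 => h0 ((TwoSidedIdeal.mem_bot S).1 hs0 ▸ hs))
  exact ⟨P, hP⟩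

theorem IsMSystem.exists_isPrimeIdeal_disjoint {M : Set S} (hM : IsMSystem M)
    (hne : M.Nonempty) (h0 : (0 : S) ∉ M) :
    ∃ P : TwoSidedIdeal S, IsPrimeIdeal P ∧ ∀ s ∈ M, s ∉ P := by
  obtain ⟨P, hP⟩ := exists_maximal_disjoint h0
  have exists_mem_of_lt {J : TwoSidedIdeal S} (hPJ : P ≤ J) {b : S} (hbJ : b ∈ J) (hbP : b ∉ P) :
      ∃ s ∈ M, s ∈ J := by
    by_contra! hJ
    exact hbP (hP.2 hJ hPJ hbJ)
  refine ⟨P, ⟨?_, fun a b hab => ?_⟩, hP.1⟩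
  · rintro rfl
    obtain ⟨s, hs⟩ := hne
    exact hP.1 s hs trivial
  · by_contra! hnot
    obtain ⟨t, htM, ht⟩ := exists_mem_of_lt (le_rightColon P a) (mem_rightColon.2 hab) hnot.2
    obtain ⟨s, hsM, hs⟩ := exists_mem_of_lt (le_leftColon P t)
      (mem_leftColon.2 (mem_rightColon.1 ht)) hnot.1
    obtain ⟨r, hr⟩ := hM s hsM t htM
    exact hP.1 _ hr (mem_leftColon.1 hs r)

theorem IsNSystem.exists_isMSystem_subset {N : Set S} (hN : IsNSystem N) {a : S} (ha : a ∈ N) :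
    ∃ M ⊆ N, a ∈ M ∧ IsMSystem M := by
  choose! f hf using hN
  let u : ℕ → S := fun k => (fun b => b * f b * b)^[k] a
  have u_succ (k) : u (k + 1) = u k * f (u k) * u k := Function.iterate_succ_apply' _ k a
  have u_mem (k) : u k ∈ N := by
    induction k with
    | zero => exact ha
    | succ k ih => exact u_succ k ▸ hf _ ih
  have left_factor {k l} (hkl : k ≤ l) : ∃ r, u l = u k * r := by
    induction l, hkl using Nat.le_induction with
    | base => exact ⟨1, (mul_one _).symm⟩
    | succ l _ ih =>
      obtain ⟨r, hr⟩ := ih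
      exact ⟨r * f (u l) * u l, by rw [u_succ, ← mul_assoc, ← mul_assoc, ← hr]⟩
  have right_factor {k l} (hkl : k ≤ l) : ∃ r, u l = r * u k := by
    induction l, hkl using Nat.le_induction with
    | base => exact ⟨1, (one_mul _).symm⟩
    | succ l _ ih =>
      obtain ⟨r, hr⟩ := ih
      exact ⟨u l * f (u l) * r, by rw [u_succ, mul_assoc _ r, ← hr]⟩
  refine ⟨Set.range u, Set.range_subset_iff.2 u_mem, ⟨0, rfl⟩, ?_⟩
  rintro _ ⟨k, rfl⟩ _ ⟨l, rfl⟩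
  obtain ⟨r, hr⟩ := left_factor (le_max_left k l)
  obtain ⟨s, hs⟩ := right_factor (le_max_right k l)
  refine ⟨r * f (u (max k l)) * s, max k l + 1, ?_⟩
  calc u (max k l + 1) = u k * r * f (u (max k l)) * (s * u l) := by rw [u_succ, ← hr, ← hs]
    _ = u k * (r * f (u (max k l)) * s) * u l := by simp only [mul_assoc]

theorem mem_primeRadical {a : S} :
    a ∈ primeRadical S ↔ ∀ P : TwoSidedIdeal S, IsPrimeIdeal P → a ∈ P :=
  TwoSidedIdeal.mem_sInf S

theorem IsNSystem.notMem_primeRadical {N : Set S} (hN : IsNSystem N) (h0 : (0 : S) ∉ N) {a : S}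
    (ha : a ∈ N) : a ∉ primeRadical S := by
  obtain ⟨M, hMN, haM, hM⟩ := hN.exists_isMSystem_subset ha
  obtain ⟨P, hP, hdisj⟩ := hM.exists_isPrimeIdeal_disjoint ⟨a, haM⟩ fun h => h0 (hMN h)
  exact fun hrad => hdisj a haM (mem_primeRadical.1 hrad P hP)

theorem isNilpotent_of_mem_primeRadical {a : S} (ha : a ∈ primeRadical S) : IsNilpotent a := by
  by_contra hnil
  have hN : IsNSystem {b : S | ¬IsNilpotent b} := fun b hb =>
    ⟨1, by simpa [← pow_two, IsNilpotent.pow_iff_pos] using hb⟩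
  exact hN.notMem_primeRadical (fun h => h IsNilpotent.zero) hnil ha

theorem isPrimeIdeal_sInf_of_isChain {c : Set (TwoSidedIdeal S)} (hc : IsChain (· ≤ ·) c)
    (hne : c.Nonempty) (hprime : ∀ I ∈ c, IsPrimeIdeal I) : IsPrimeIdeal (sInf c) := by
  refine ⟨fun htop => ?_, fun a b hab => ?_⟩
  · obtain ⟨I, hI⟩ := hne
    exact (hprime I hI).ne_top (top_le_iff.1 (htop ▸ sInf_le hI))
  · simp only [TwoSidedIdeal.mem_sInf] at hab ⊢
    by_contra! hnot
    obtain ⟨⟨I, hI, ha⟩, J, hJ, hb⟩ := hnot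
    obtain hIJ | hJI := hc.total hI hJ
    · exact ((hprime I hI).mem_or_mem a b fun s => hab s I hI).elim ha fun h => hb (hIJ h)
    · exact ((hprime J hJ).mem_or_mem a b fun s => hab s J hJ).elim (fun h => ha (hJI h)) hb

theorem IsPrimeIdeal.exists_minimalPrimeIdeal_le {P : TwoSidedIdeal S} (hP : IsPrimeIdeal P) :
    ∃ Q ∈ minimalPrimeIdeals S, Q ≤ P := by
  obtain ⟨Q, hQP, hQ⟩ := zorn_le_nonempty₀ (α := (TwoSidedIdeal S)ᵒᵈ)
    {I | IsPrimeIdeal (OrderDual.ofDual I)}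
    (fun c hprime hc I hI =>
      ⟨OrderDual.toDual (sInf (OrderDual.toDual ⁻¹' c)),
        isPrimeIdeal_sInf_of_isChain hc.symm ⟨I, hI⟩ hprime,
        fun J hJ => sInf_le (α := TwoSidedIdeal S) hJ⟩)
    (OrderDual.toDual P) hP
  exact ⟨OrderDual.ofDual Q, ⟨hQ.1, fun I hI hIQ => hQ.2 (y := OrderDual.toDual I) hI hIQ⟩, hQP⟩

theorem mem_primeRadical_iff_forall_mem_minimalPrimeIdeals {a : S} :
    a ∈ primeRadical S ↔ ∀ P ∈ minimalPrimeIdeals S, a ∈ P := by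
  refine ⟨fun ha P hP => mem_primeRadical.1 ha P hP.1, fun ha => mem_primeRadical.2 fun P hP => ?_⟩
  obtain ⟨Q, hQ, hQP⟩ := hP.exists_minimalPrimeIdeal_le
  exact hQP (ha Q hQ)

theorem exists_mem_notMem_of_mem_minimalPrimeIdeals {P Q : TwoSidedIdeal S}
    (hP : P ∈ minimalPrimeIdeals S) (hQ : Q ∈ minimalPrimeIdeals S) (hne : P ≠ Q) :
    ∃ a ∈ P, a ∉ Q := by
  by_contra! hle
  exact hne (le_antisymm hle (hQ.2 hP.1 hle))

end PrimeExistence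

section TwoPrimal

variable {S : Type*} [Ring S]

/-- A two-sided ideal is completely prime if it is proper and its complement is closed under
multiplication. -/
structure IsCompletelyPrime (P : TwoSidedIdeal S) : Prop where
  one_notMem : (1 : S) ∉ P
  mem_or_mem : ∀ a b : S, a * b ∈ P → a ∈ P ∨ b ∈ P

theorem IsCompletelyPrime.mul_notMem {P : TwoSidedIdeal S} (hP : IsCompletelyPrime P) {a b : S}
    (ha : a ∉ P) (hb : b ∉ P) : a * b ∉ P :=
  fun hab => (hP.mem_or_mem a b hab).elim ha hb

theorem IsCompletelyPrime.mem_of_isNilpotent {P : TwoSidedIdeal S} (hP : IsCompletelyPrime P)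
    {a : S} (ha : IsNilpotent a) : a ∈ P := by
  obtain ⟨k, hk⟩ := ha
  by_contra haP
  have pow_notMem (m) : a ^ m ∉ P := by
    induction m with
    | zero => simpa only [pow_zero] using hP.one_notMem
    | succ m ih => exact pow_succ a m ▸ hP.mul_notMem ih haP
  exact pow_notMem k (hk ▸ P.zero_mem)

theorem IsTwoPrimal.mem_primeRadical_iff (h : IsTwoPrimal S) {a : S} :
    a ∈ primeRadical S ↔ IsNilpotent a :=
  Set.ext_iff.1 h a

theorem IsTwoPrimal.isNilpotent_mul_mul (h : IsTwoPrimal S) {a b : S}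
    (hab : IsNilpotent (a * b)) (r : S) : IsNilpotent (a * r * b) := by
  have hba : b * a ∈ primeRadical S := h.mem_primeRadical_iff.2 (isNilpotent_mul_swap hab)
  have hsq : (a * r * b) ^ 2 ∈ primeRadical S := by
    have := (primeRadical S).mul_mem_right _ (r * b) ((primeRadical S).mul_mem_left (a * r) _ hba)
    simpa only [pow_two, mul_assoc] using this
  exact (IsNilpotent.pow_iff_pos two_ne_zero).1 (h.mem_primeRadical_iff.1 hsq)

theorem IsPrimeIdeal.mem_iff_isNilpotent_mul (h : IsTwoPrimal S) {P Q : TwoSidedIdeal S}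
    (hP : IsPrimeIdeal P) (hPQ : ∀ a, a ∈ P → a ∈ Q → IsNilpotent a) {q : S} (hqQ : q ∈ Q)
    (hqP : q ∉ P) (a : S) : a ∈ P ↔ IsNilpotent (a * q) := by
  refine ⟨fun ha => hPQ _ (P.mul_mem_right _ _ ha) (Q.mul_mem_left _ _ hqQ), fun haq => ?_⟩
  have hsub (s : S) : a * s * q ∈ P :=
    mem_primeRadical.1 (h.mem_primeRadical_iff.2 (h.isNilpotent_mul_mul haq s)) P hP
  exact (hP.mem_or_mem a q hsub).resolve_right hqP

theorem IsPrimeIdeal.isCompletelyPrime_of_mem_iff (h : IsTwoPrimal S) {P : TwoSidedIdeal S}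
    (hP : IsPrimeIdeal P) {q : S} (hPq : ∀ a, a ∈ P ↔ IsNilpotent (a * q)) :
    IsCompletelyPrime P where
  one_notMem h1 := hP.ne_top (P.one_mem_iff.1 h1)
  mem_or_mem a b hab := hP.mem_or_mem a b fun s => by
    have habq : IsNilpotent (a * (b * q)) := by simpa only [mul_assoc] using (hPq _).1 hab
    rw [hPq, mul_assoc]
    exact h.isNilpotent_mul_mul habq s

end TwoPrimal

section VanishLE

variable {S : Type*} [Ring S]

/-- The preorder comparing elements by the two-sided products that they make vanish. Under
compatibility `σ_i` does not change the class of an element and `δ_i` moves it up. -/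
def VanishLE (a b : S) : Prop :=
  ∀ u v : S, u * a * v = 0 → u * b * v = 0

namespace VanishLE

variable {a b c d : S}

theorem refl (a : S) : VanishLE a a := fun _ _ => id

theorem trans (hab : VanishLE a b) (hbc : VanishLE b c) : VanishLE a c :=
  fun u v h => hbc u v (hab u v h)

theorem mul (hab : VanishLE a b) (hcd : VanishLE c d) : VanishLE (a * c) (b * d) := by
  intro u v h
  have hbc : u * b * (c * v) = 0 := hab u (c * v) (by simpa only [mul_assoc] using h)
  simpa only [mul_assoc] using hcd (u * b) v (by simpa only [mul_assoc] using hbc)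

theorem pow (hab : VanishLE a b) (k : ℕ) : VanishLE (a ^ k) (b ^ k) := by
  induction k with
  | zero => simpa only [pow_zero] using refl 1
  | succ k ih => simpa only [pow_succ] using ih.mul hab

theorem eq_zero (hab : VanishLE a b) (ha : a = 0) : b = 0 := by
  simpa using hab 1 1 (by simpa using ha)

theorem isNilpotent (hab : VanishLE a b) : IsNilpotent a → IsNilpotent b :=
  fun ⟨k, hk⟩ => ⟨k, (hab.pow k).eq_zero hk⟩

end VanishLE

end VanishLE

section Compatible

theorem iterComp_single {n : ℕ} {S : Type*} (f : Fin n → S → S) (i : Fin n) :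
    iterComp f (Pi.single i 1) = f i := by
  let F : Fin n → Function.End S := f
  change ((List.finRange n).map fun j => F j ^ (Pi.single i 1 : Fin n → ℕ) j).prod = F i
  rw [List.prod_map_eq_pow_single i _ fun j hj _ => by simp [hj],
    List.count_eq_one_of_mem (List.nodup_finRange n) (List.mem_finRange i)]
  simp

variable {n : ℕ} {S : Type*} [Ring S] {σ δ : Fin n → S → S}

theorem IsCompatible.mul_sigma_eq_zero_iff (hc : IsCompatible σ δ) (a b : S) (i : Fin n) :
    a * σ i b = 0 ↔ a * b = 0 := by
  simpa only [iterComp_single] using hc.sigma_iff a b (Pi.single i 1)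

theorem IsCompatible.mul_delta_eq_zero (hc : IsCompatible σ δ) {a b : S} (i : Fin n)
    (hab : a * b = 0) : a * δ i b = 0 := by
  simpa only [iterComp_single] using hc.delta_of a b (Pi.single i 1) hab

theorem IsCompatible.mul_sigma_mul_eq_zero_iff (hc : IsCompatible σ δ) {i : Fin n}
    (hσ : ∀ a b, σ i (a * b) = σ i a * σ i b) (u a v : S) :
    u * σ i a * v = 0 ↔ u * a * v = 0 := by
  rw [← hc.mul_sigma_eq_zero_iff _ v i, mul_assoc, ← hσ, hc.mul_sigma_eq_zero_iff, mul_assoc]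

theorem IsCompatible.vanishLE_delta (hc : IsCompatible σ δ) {i : Fin n}
    (hσ : ∀ a b, σ i (a * b) = σ i a * σ i b)
    (hδ : ∀ a b, δ i (a * b) = σ i a * δ i b + δ i a * b) (a : S) : VanishLE a (δ i a) := by
  intro u v h
  have hσδ : u * σ i a * δ i v = 0 :=
    hc.mul_delta_eq_zero i ((hc.mul_sigma_mul_eq_zero_iff hσ u a v).2 h)
  have hδav : u * δ i (a * v) = 0 := hc.mul_delta_eq_zero i (by rwa [← mul_assoc])
  rwa [hδ, mul_add, ← mul_assoc, hσδ, zero_add, ← mul_assoc] at hδav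

end Compatible

section Monomial

theorem mul_prod_map_pow_of_pairwise_lt {M ι : Type*} [Monoid M] [LinearOrder ι] (x : ι → M)
    {i : ι} {α : ι → ℕ} (hα : ∀ k < i, α k = 0) {l : List ι} (hl : l.Pairwise (· < ·))
    (hi : i ∈ l) :
    x i * (l.map fun k => x k ^ α k).prod =
      (l.map fun k => x k ^ (α + Pi.single i 1 : ι → ℕ) k).prod := by
  induction l with
  | nil => simp at hi
  | cons k t ih =>
    obtain ⟨hk, ht⟩ := List.pairwise_cons.1 hl
    rw [List.map_cons, List.prod_cons, List.map_cons, List.prod_cons]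
    obtain rfl | hit := List.mem_cons.1 hi
    · have htail :
          (t.map fun j => x j ^ (α + Pi.single i 1 : ι → ℕ) j) = t.map fun j => x j ^ α j :=
        List.map_congr_left fun j hj => by simp [(hk j hj).ne']
      rw [htail, ← mul_assoc, ← pow_succ']
      simp
    · have hki : k < i := hk i hit
      rw [hα k hki, pow_zero, one_mul, ih ht hit]
      simp [hki.ne, hα k hki]

theorem exists_eq_add_single {n : ℕ} {α : Fin n → ℕ} (hα : α ≠ 0) :
    ∃ (j : Fin n) (β : Fin n → ℕ), α = β + Pi.single j 1 ∧ ∀ k < j, β k = 0 := by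
  obtain ⟨j, hj, hmin⟩ := wellFounded_lt.has_min {k | α k ≠ 0} (Function.ne_iff.1 hα)
  have hle : Pi.single j 1 ≤ α := fun k => by
    obtain rfl | hkj := eq_or_ne k j
    · simpa using Nat.one_le_iff_ne_zero.2 hj
    · simp [hkj]
  refine ⟨j, α - Pi.single j 1, (tsub_add_cancel_of_le hle).symm, fun k hk => ?_⟩
  have hαk : α k = 0 := not_not.1 fun h => hmin k h hk
  simp [hαk]

@[elab_as_elim]
theorem exponent_induction {n : ℕ} {p : (Fin n → ℕ) → Prop} (zero : p 0)
    (add_single : ∀ (j : Fin n) (β : Fin n → ℕ), (∀ k < j, β k = 0) → p β →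
      p (β + Pi.single j 1)) (α : Fin n → ℕ) : p α := by
  induction hm : ∑ k, α k generalizing α with
  | zero => rwa [funext fun k => Finset.sum_eq_zero_iff.1 hm k (Finset.mem_univ k)]
  | succ m ih =>
    obtain ⟨j, β, rfl, hβ⟩ := exists_eq_add_single (α := α) (by rintro rfl; simp at hm)
    exact add_single j β hβ (ih β (by simpa [Finset.sum_add_distrib] using hm))

variable {A : Type*} [Ring A] {n : ℕ}

theorem var_mul_monomial (x : Fin n → A) {i : Fin n} {α : Fin n → ℕ} (hα : ∀ k < i, α k = 0) :
    x i * monomial x α = monomial x (α + Pi.single i 1) :=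
  mul_prod_map_pow_of_pairwise_lt x hα (List.pairwise_lt_finRange n) (List.mem_finRange i)

end Monomial

namespace IsSkewPBW

variable {A : Type*} [Ring A] {n : ℕ} {R : Subring A} {x : Fin n → A}

section Maps

variable (h : IsSkewPBW R x)

theorem sigma_mul_and_delta_mul (i : Fin n) (a b : R) :
    h.sigma i (a * b) = h.sigma i a * h.sigma i b ∧
      h.delta i (a * b) = h.sigma i a * h.delta i b + h.delta i a * b := by
  have hexpand : x i * (a * b : R) = (h.sigma i a * h.sigma i b : R) * x i +
      (h.sigma i a * h.delta i b + h.delta i a * b : R) := by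
    push_cast
    rw [← mul_assoc, h.mul_eq i a, add_mul, mul_assoc _ (x i), h.mul_eq i b]
    noncomm_ring
  exact (h.eq_sigma_and_eq_delta i _ _ _ hexpand).imp Eq.symm Eq.symm

theorem sigma_one (i : Fin n) : h.sigma i 1 = 1 :=
  (h.eq_sigma_and_eq_delta i 1 1 0 (by simp)).1.symm

variable {h} (hc : IsCompatible h.sigma h.delta) (i : Fin n) (a : R)
include hc

theorem vanishLE_sigma : VanishLE a (h.sigma i a) := fun u v =>
  (hc.mul_sigma_mul_eq_zero_iff (fun a b => (h.sigma_mul_and_delta_mul i a b).1) u a v).2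

theorem sigma_vanishLE : VanishLE (h.sigma i a) a := fun u v =>
  (hc.mul_sigma_mul_eq_zero_iff (fun a b => (h.sigma_mul_and_delta_mul i a b).1) u a v).1

theorem vanishLE_delta : VanishLE a (h.delta i a) :=
  hc.vanishLE_delta (fun a b => (h.sigma_mul_and_delta_mul i a b).1)
    (fun a b => (h.sigma_mul_and_delta_mul i a b).2) a

end Maps

section Basis

variable (h : IsSkewPBW R x)

theorem basis_apply (α : Fin n → ℕ) : h.basis α = monomial x α := by
  simp [basis]

theorem repr_monomial (α : Fin n → ℕ) : h.basis.repr (monomial x α) = Finsupp.single α 1 := by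
  rw [← h.basis_apply, h.basis.repr_self]

theorem sum_repr_smul_monomial (f : A) :
    ∑ γ ∈ (h.basis.repr f).support, h.basis.repr f γ • monomial x γ = f := by
  simpa only [Finsupp.linearCombination_apply, Finsupp.sum, h.basis_apply] using
    h.basis.linearCombination_repr f

theorem var_mul_smul (i : Fin n) (r : R) (f : A) :
    x i * (r • f) = h.sigma i r • (x i * f) + h.delta i r • f := by
  simp only [Subring.smul_def, smul_eq_mul]
  rw [← mul_assoc, h.mul_eq i r]
  noncomm_ring

include h in
theorem var_mul_mem_of_mem_span {i : Fin n} {G : Set A} {W : Submodule R A} (hGW : G ⊆ W)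
    (hG : ∀ g ∈ G, x i * g ∈ W) {f : A} (hf : f ∈ Submodule.span R G) : x i * f ∈ W := by
  induction hf using Submodule.span_induction with
  | mem g hg => exact hG g hg
  | zero => simp
  | add f g _ _ ihf ihg => simpa only [mul_add] using W.add_mem ihf ihg
  | smul r f hf ih =>
    rw [h.var_mul_smul]
    exact W.add_mem (W.smul_mem _ ih) (W.smul_mem _ (Submodule.span_le.2 hGW hf))

include h in
theorem mul_mem_of_forall_var_mul_mem {L : Submodule R A} (hL : ∀ i, ∀ f ∈ L, x i * f ∈ L)
    (g : A) {f : A} (hf : f ∈ L) : g * f ∈ L := by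
  have monomial_mul_mem (α : Fin n → ℕ) : monomial x α * f ∈ L := by
    induction α using exponent_induction with
    | zero => simpa only [monomial_zero, one_mul] using hf
    | add_single j β hβ ih =>
      rw [← var_mul_monomial x hβ, mul_assoc]
      exact hL j _ ih
  rw [← h.sum_repr_smul_monomial g, Finset.sum_mul]
  refine L.sum_mem fun γ _ => ?_
  rw [smul_mul_assoc]
  exact L.smul_mem _ (monomial_mul_mem γ)

theorem repr_coe_mul_monomial (r : R) (α : Fin n → ℕ) :
    h.basis.repr (r * monomial x α) = Finsupp.single α r := by
  change h.basis.repr (r • monomial x α) = _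
  rw [map_smul, h.repr_monomial, Finsupp.smul_single, smul_eq_mul, mul_one]

include h in
theorem coe_ne_coe_mul_monomial {r : R} (hr : r ≠ 0) {α : Fin n → ℕ} (hα : α ≠ 0) :
    (r : A) ≠ r * monomial x α := fun heq => by
  have hcoeff := h.repr_coe_mul_monomial r 0
  rw [monomial_zero, mul_one, heq, h.repr_coe_mul_monomial] at hcoeff
  exact hα (Finsupp.single_left_injective hr hcoeff)

end Basis

section Nilpotent

variable {h : IsSkewPBW R x} (hc : IsCompatible h.sigma h.delta)
include hc

theorem exists_vanishLE_mul_mul_notMem {P : TwoSidedIdeal A} (hP : IsPrimeIdeal P) {d : R}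
    (hd : (d : A) ∉ P) : ∃ r e : R, VanishLE d e ∧ (d * r * e : A) ∉ P := by
  by_contra! hmem
  let G : Set A := {g | ∃ e : R, VanishLE d e ∧ ∃ f : A, g = e • f}
  let L : Submodule R A := Submodule.span R G
  have smul_mem {e : R} (he : VanishLE d e) (f : A) : e • f ∈ L :=
    Submodule.subset_span ⟨e, he, f, rfl⟩
  have var_mul_mem (i : Fin n) : ∀ f ∈ L, x i * f ∈ L := fun f hf => by
    refine h.var_mul_mem_of_mem_span Submodule.subset_span ?_ hf
    rintro _ ⟨e, he, f, rfl⟩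
    rw [h.var_mul_smul]
    exact L.add_mem (smul_mem (he.trans (vanishLE_sigma hc i e)) _)
      (smul_mem (he.trans (vanishLE_delta hc i e)) _)
  have mul_mem {g : A} (hg : g ∈ L) : ∀ r : R, (d * r * g : A) ∈ P := by
    induction hg using Submodule.span_induction with
    | mem g hg =>
      obtain ⟨e, he, f, rfl⟩ := hg
      exact fun r => mul_assoc (d * r : A) e f ▸ P.mul_mem_right _ f (hmem r e he)
    | zero => simp
    | add f g _ _ ihf ihg => exact fun r => mul_add (d * r : A) f g ▸ P.add_mem (ihf r) (ihg r)
    | smul s f _ ih =>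
      intro r
      simpa only [Subring.smul_def, smul_eq_mul, Subring.coe_mul, mul_assoc] using ih (r * s)
  have hdL : (d : A) ∈ L := by simpa [Subring.smul_def] using smul_mem (VanishLE.refl d) 1
  refine hd ((hP.mem_or_mem d d fun s => ?_).elim id id)
  simpa [mul_assoc] using mul_mem (h.mul_mem_of_forall_var_mul_mem var_mul_mem s hdL) 1

theorem coe_mem_of_isNilpotent (htp : IsTwoPrimal R) {P : TwoSidedIdeal A} (hP : IsPrimeIdeal P)
    {a : R} (ha : IsNilpotent a) : (a : A) ∈ P := by
  by_contra haP
  let N : Set R := {c | ∃ d, VanishLE c d ∧ (d : A) ∉ P}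
  have hN : IsNSystem N := by
    rintro c ⟨d, hcd, hdP⟩
    obtain ⟨r, e, hde, hP⟩ := exists_vanishLE_mul_mul_notMem hc hP hdP
    exact ⟨r, d * r * e, (hcd.mul (.refl r)).mul (hcd.trans hde), by simpa using hP⟩
  have hN0 : (0 : R) ∉ N := by
    rintro ⟨d, hd, hdP⟩
    exact hdP (by simp [hd.eq_zero rfl])
  exact hN.notMem_primeRadical hN0 ⟨a, .refl a, haP⟩ (htp.mem_primeRadical_iff.2 ha)

theorem isNilpotent_of_forall_isNilpotent_repr (htp : IsTwoPrimal R) {f : A}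
    (hf : ∀ α, IsNilpotent (h.basis.repr f α)) : IsNilpotent f := by
  refine isNilpotent_of_mem_primeRadical (mem_primeRadical.2 fun P hP => ?_)
  rw [← h.sum_repr_smul_monomial f]
  exact sum_mem fun α _ => P.mul_mem_right _ _ (coe_mem_of_isNilpotent hc htp hP (hf α))

end Nilpotent

section Extend

variable (h : IsSkewPBW R x)

/-- An ideal of the coefficient ring is invariant if it is mapped into itself by all `σ_i` and
`δ_i` and contains the preimages of its elements under all `σ_i`. -/
structure IsInvariant (P : TwoSidedIdeal R) : Prop where
  sigma_mem_iff : ∀ (i : Fin n) (a : R), h.sigma i a ∈ P ↔ a ∈ P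
  delta_mem : ∀ (i : Fin n) (a : R), a ∈ P → h.delta i a ∈ P

/-- The elements of `A` whose coefficients at the exponents in `s` lie in `P`. The ideal `PA`, the
filtration by degree and the terms below a leading term are all of this form. -/
noncomputable def coeffSubmodule (P : TwoSidedIdeal R) (s : Set (Fin n → ℕ)) : Submodule R A where
  carrier := {f | ∀ γ ∈ s, h.basis.repr f γ ∈ P}
  zero_mem' γ _ := by simp
  add_mem' hf hg γ hγ := by simpa using P.add_mem (hf γ hγ) (hg γ hγ)
  smul_mem' r f hf γ hγ := by simpa using P.mul_mem_left r _ (hf γ hγ)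

variable {h} {P Q : TwoSidedIdeal R} {s t : Set (Fin n → ℕ)}

theorem isInvariant_bot : h.IsInvariant ⊥ where
  sigma_mem_iff i a := by
    simp only [TwoSidedIdeal.mem_bot]
    refine ⟨fun hσ => ?_, by rintro rfl; simp [sigma]⟩
    by_contra ha
    obtain ⟨c, hc, hca⟩ := h.exists_coeff i a ha
    exact hc ((h.eq_sigma_and_eq_delta i a c ⟨_, hca⟩ (by simp)).1.trans hσ)
  delta_mem i a := by
    simp only [TwoSidedIdeal.mem_bot]
    rintro rfl
    simp [delta]

theorem isInvariant_of_mem_iff_isNilpotent_mul (hc : IsCompatible h.sigma h.delta) {q : R}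
    (hPq : ∀ a, a ∈ P ↔ IsNilpotent (a * q)) : h.IsInvariant P where
  sigma_mem_iff i a := by
    rw [hPq, hPq]
    exact ⟨((sigma_vanishLE hc i a).mul (.refl q)).isNilpotent,
      ((vanishLE_sigma hc i a).mul (.refl q)).isNilpotent⟩
  delta_mem i a := by
    rw [hPq, hPq]
    exact ((vanishLE_delta hc i a).mul (.refl q)).isNilpotent

theorem coeffSubmodule_mono (hPQ : P ≤ Q) (hts : t ⊆ s) :
    h.coeffSubmodule P s ≤ h.coeffSubmodule Q t :=
  fun _ hf γ hγ => hPQ (hf γ (hts hγ))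

theorem monomial_mem_coeffSubmodule {γ : Fin n → ℕ} (hγ : γ ∉ s) :
    monomial x γ ∈ h.coeffSubmodule P s := fun β hβ => by
  rw [h.repr_monomial, Finsupp.single_eq_of_ne (by rintro rfl; exact hγ hβ)]
  exact P.zero_mem

theorem smul_mem_coeffSubmodule_of_mem {r : R} (hr : r ∈ P) (f : A) :
    r • f ∈ h.coeffSubmodule P s := fun γ _ => by
  simpa using P.mul_mem_right r _ hr

theorem mul_mem_coeffSubmodule {f g : A} (hf : f ∈ h.coeffSubmodule P s)
    (hg : ∀ γ ∉ s, monomial x γ * g ∈ h.coeffSubmodule P t) : f * g ∈ h.coeffSubmodule P t := by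
  rw [← h.sum_repr_smul_monomial f, Finset.sum_mul]
  refine sum_mem fun γ _ => ?_
  rw [smul_mul_assoc]
  by_cases hγ : γ ∈ s
  · exact smul_mem_coeffSubmodule_of_mem (hf γ hγ) _
  · exact Submodule.smul_mem _ _ (hg γ hγ)

theorem IsInvariant.var_mul_mem_coeffSubmodule (hP : h.IsInvariant P) {i : Fin n} (hts : t ⊆ s)
    (hvar : ∀ γ ∉ s, x i * monomial x γ ∈ h.coeffSubmodule P t) {f : A}
    (hf : f ∈ h.coeffSubmodule P s) : x i * f ∈ h.coeffSubmodule P t := by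
  rw [← h.sum_repr_smul_monomial f, Finset.mul_sum]
  refine sum_mem fun γ _ => ?_
  rw [h.var_mul_smul]
  by_cases hγ : γ ∈ s
  · exact add_mem (smul_mem_coeffSubmodule_of_mem ((hP.sigma_mem_iff i _).2 (hf γ hγ)) _)
      (smul_mem_coeffSubmodule_of_mem (hP.delta_mem i _ (hf γ hγ)) _)
  · exact add_mem (Submodule.smul_mem _ _ (hvar γ hγ))
      (Submodule.smul_mem _ _ (monomial_mem_coeffSubmodule fun hγt => hγ (hts hγt)))

/-- The ideal `PA` of the elements of `A` with all coefficients in `P`. -/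
noncomputable def IsInvariant.extend (hP : h.IsInvariant P) : TwoSidedIdeal A :=
  TwoSidedIdeal.mk' (h.coeffSubmodule P Set.univ) (zero_mem _) add_mem neg_mem
    (fun {f _} hg => h.mul_mem_of_forall_var_mul_mem (fun _ _ hf =>
      hP.var_mul_mem_coeffSubmodule subset_rfl (fun _ hγ => (hγ trivial).elim) hf) f hg)
    (fun hf => mul_mem_coeffSubmodule hf fun _ hγ => (hγ trivial).elim)

theorem IsInvariant.mem_extend (hP : h.IsInvariant P) {f : A} :
    f ∈ hP.extend ↔ ∀ α, h.basis.repr f α ∈ P := by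
  simp [extend, TwoSidedIdeal.mem_mk', coeffSubmodule]

theorem IsInvariant.coe_mul_monomial_mem_extend_iff (hP : h.IsInvariant P) {r : R}
    (α : Fin n → ℕ) : (r : A) * monomial x α ∈ hP.extend ↔ r ∈ P := by
  rw [hP.mem_extend, h.repr_coe_mul_monomial]
  refine ⟨fun hr => by simpa using hr α, fun hr β => ?_⟩
  obtain rfl | hβ := eq_or_ne β α
  · simpa using hr
  · simp [hβ]

theorem IsInvariant.coe_mem_extend_iff (hP : h.IsInvariant P) {r : R} :
    (r : A) ∈ hP.extend ↔ r ∈ P := by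
  simpa [monomial_zero] using hP.coe_mul_monomial_mem_extend_iff (r := r) 0

end Extend

section VarMulMonomial

variable (h : IsSkewPBW R x)

/-- The elements of `A` of total degree at most `m`. -/
noncomputable abbrev degLE (m : ℕ) : Submodule R A :=
  h.coeffSubmodule ⊥ {γ | m < ∑ k, γ k}

variable {h}

theorem monomial_mem_degLE {γ : Fin n → ℕ} {m : ℕ} (hγ : ∑ k, γ k ≤ m) :
    monomial x γ ∈ h.degLE m :=
  monomial_mem_coeffSubmodule hγ.not_gt

theorem degLE_mono {l m : ℕ} (hlm : l ≤ m) : h.degLE l ≤ h.degLE m :=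
  coeffSubmodule_mono le_rfl fun _ hγ => hlm.trans_lt hγ

theorem coe_add_sum_mul_mem_degLE_one (r₀ : R) (r : Fin n → R) :
    (r₀ : A) + ∑ k, (r k : A) * x k ∈ h.degLE 1 := by
  refine add_mem ?_ (sum_mem fun k _ => ?_)
  · simpa [monomial_zero, Subring.smul_def] using
      (h.degLE 1).smul_mem r₀ (monomial_mem_degLE (γ := 0) (by simp))
  · simpa [monomial_single, Subring.smul_def] using
      (h.degLE 1).smul_mem (r k) (monomial_mem_degLE (γ := Pi.single k 1) (by simp))

variable (h)

include h in
/- Exchanging `x_i` and `x_j` twice shows that the coefficient `d` has a left inverse. -/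
theorem exists_comm_of_lt {i j : Fin n} (hji : j < i) :
    ∃ d d' r₀ : R, ∃ r : Fin n → R, d' * d = 1 ∧
      x i * x j = d * (x j * x i) + (r₀ + ∑ k, (r k : A) * x k) := by
  obtain ⟨d, -, r₀, r, hd⟩ := h.exists_comm j i
  obtain ⟨d', -, s₀, s, hd'⟩ := h.exists_comm i j
  refine ⟨d, d', r₀, r, ?_, by rw [← hd]; abel⟩
  let μ : Fin n → ℕ := Pi.single i 1 + Pi.single j 1
  have hμ : x j * x i = monomial x μ := by
    rw [← monomial_single x i]
    exact var_mul_monomial x fun k hk => by simp [(hk.trans hji).ne]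
  have hexpand : monomial x μ - (d' * d) • monomial x μ =
      d' • ((r₀ : A) + ∑ k, (r k : A) * x k) + (s₀ + ∑ k, (s k : A) * x k) := by
    rw [← hd, ← hd', ← hμ]
    simp only [Subring.smul_def, smul_eq_mul, Subring.coe_mul]
    noncomm_ring
  have hmem : monomial x μ - (d' * d) • monomial x μ ∈ h.degLE 1 := by
    rw [hexpand]
    exact add_mem (Submodule.smul_mem _ _ (coe_add_sum_mul_mem_degLE_one _ _))
      (coe_add_sum_mul_mem_degLE_one _ _)
  have hcoeff := hmem μ (by simp [μ, Finset.sum_add_distrib])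
  simp only [TwoSidedIdeal.mem_bot, map_sub, map_smul, h.repr_monomial, Finsupp.coe_sub,
    Finsupp.coe_smul, Pi.sub_apply, Pi.smul_apply, Finsupp.single_eq_same, smul_eq_mul,
    mul_one] at hcoeff
  exact (sub_eq_zero.1 hcoeff).symm

theorem var_mul_monomial_add_single {i j : Fin n} (hji : j < i) {β : Fin n → ℕ}
    (hβ : ∀ k < j, β k = 0) {d r₀ : R} {r : Fin n → R}
    (hcomm : x i * x j = d * (x j * x i) + (r₀ + ∑ k, (r k : A) * x k)) (u : R) :
    x i * monomial x (β + Pi.single j 1) -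
        (d * h.sigma j u) • monomial x (β + Pi.single j 1 + Pi.single i 1) =
      d • (x j * (x i * monomial x β - u • monomial x (β + Pi.single i 1))) +
        (d * h.delta j u) • monomial x (β + Pi.single i 1) +
        (r₀ • monomial x β + ∑ k, r k • (x k * monomial x β)) := by
  have hi : monomial x (β + Pi.single j 1 + Pi.single i 1) =
      x j * monomial x (β + Pi.single i 1) := by
    rw [add_right_comm]
    exact (var_mul_monomial x fun k hk => by simp [hβ k hk, (hk.trans hji).ne]).symm
  rw [mul_sub, h.var_mul_smul, hi, ← var_mul_monomial x hβ, ← mul_assoc (x i), hcomm]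
  simp only [Subring.smul_def, smul_eq_mul, Subring.coe_mul, add_mul, Finset.sum_mul]
  noncomm_ring

theorem exists_var_mul_monomial (i : Fin n) (α : Fin n → ℕ) :
    ∃ u u' : R, u' * u = 1 ∧
      x i * monomial x α - u • monomial x (α + Pi.single i 1) ∈ h.degLE (∑ k, α k) := by
  induction hm : ∑ k, α k using Nat.strong_induction_on generalizing i α with
  | _ m ih =>
  have hvar {γ : Fin n → ℕ} (hγ : ∑ k, γ k < m) (k : Fin n) : x k * monomial x γ ∈ h.degLE m := by
    obtain ⟨u, -, -, hlow⟩ := ih _ hγ k γ rfl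
    rw [← sub_add_cancel (x k * monomial x γ) (u • monomial x (γ + Pi.single k 1))]
    exact add_mem (degLE_mono hγ.le hlow) (Submodule.smul_mem _ _
      (monomial_mem_degLE (by simpa [Finset.sum_add_distrib] using hγ)))
  by_cases hα : ∀ k < i, α k = 0
  · exact ⟨1, 1, one_mul 1, by simp [var_mul_monomial x hα]⟩
  obtain ⟨j, β, rfl, hβ⟩ := exists_eq_add_single (α := α) (by rintro rfl; simp at hα)
  have hji : j < i := by
    by_contra! hij
    exact hα fun k hk => by simp [hβ k (hk.trans_le hij), (hk.trans_le hij).ne]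
  have hβm : ∑ k, β k + 1 = m := by simpa [Finset.sum_add_distrib] using hm
  obtain ⟨u, u', hu, hlow⟩ := ih _ (by omega) i β rfl
  obtain ⟨d, d', r₀, r, hd, hcomm⟩ := h.exists_comm_of_lt hji
  refine ⟨d * h.sigma j u, h.sigma j u' * d', ?_, ?_⟩
  · rw [mul_assoc, ← mul_assoc d', hd, one_mul, ← (h.sigma_mul_and_delta_mul j u' u).1, hu,
      h.sigma_one]
  rw [h.var_mul_monomial_add_single hji hβ hcomm]
  refine add_mem (add_mem ?_ ?_) (add_mem ?_ (sum_mem fun k _ => ?_)) <;>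
    refine Submodule.smul_mem _ _ ?_
  · refine isInvariant_bot.var_mul_mem_coeffSubmodule (fun γ hγ => ?_) (fun γ hγ => ?_) hlow
    · exact (Nat.lt_of_succ_le hβm.le).trans hγ
    · exact hvar (by simp only [Set.mem_ofPred_eq] at hγ; omega) j
  · exact monomial_mem_degLE (by simp [Finset.sum_add_distrib, hβm])
  · exact monomial_mem_degLE (by omega)
  · exact hvar (by omega) k

end VarMulMonomial

section LeadingTerm

/-- The exponent as an element of the degree-lexicographic order. -/
noncomputable def degLexKey (α : Fin n → ℕ) : DegLex (Fin n →₀ ℕ) :=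
  toDegLex (Finsupp.equivFunOnFinite.symm α)

theorem degLexKey_add (α β : Fin n → ℕ) : degLexKey (α + β) = degLexKey α + degLexKey β := by
  rw [degLexKey, degLexKey, degLexKey, ← toDegLex_add]
  congr 1
  ext k
  simp

theorem degLexKey_injective : Function.Injective (degLexKey (n := n)) :=
  toDegLex_injective.comp Finsupp.equivFunOnFinite.symm.injective

theorem sum_le_of_degLexKey_le {α β : Fin n → ℕ} (hαβ : degLexKey α ≤ degLexKey β) :
    ∑ k, α k ≤ ∑ k, β k := by
  simpa [degLexKey, Finsupp.degree_eq_sum] using Finsupp.DegLex.monotone_degree hαβ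

variable (h : IsSkewPBW R x)

/-- The elements of `A` that modulo `PA` only involve monomials below `x ^ α` in the
degree-lexicographic order. -/
noncomputable abbrev lowerTerms (P : TwoSidedIdeal R) (α : Fin n → ℕ) : Submodule R A :=
  h.coeffSubmodule P {γ | degLexKey α ≤ degLexKey γ}

/-- Modulo `PA` the element `f` is the sum of `a * x ^ α` and terms below `x ^ α`. The coefficient
`a` only matters modulo `P` and may lie in `P`. -/
def HasLeadingTerm (P : TwoSidedIdeal R) (f : A) (a : R) (α : Fin n → ℕ) : Prop :=
  f - a • monomial x α ∈ h.lowerTerms P α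

variable {h} {P : TwoSidedIdeal R} {f g : A} {a b : R} {α β γ : Fin n → ℕ}

theorem degLE_le_lowerTerms {m : ℕ} (hm : m < ∑ k, α k) : h.degLE m ≤ h.lowerTerms P α :=
  coeffSubmodule_mono bot_le fun _ hγ => hm.trans_le (sum_le_of_degLexKey_le hγ)

theorem HasLeadingTerm.repr_notMem (hf : h.HasLeadingTerm P f a α) (ha : a ∉ P) :
    h.basis.repr f α ∉ P := fun hfα => by
  have hsub : h.basis.repr f α - a ∈ P := by
    simpa [h.repr_monomial] using hf α (le_refl (degLexKey α))
  exact ha (by simpa using P.sub_mem hfα hsub)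

theorem HasLeadingTerm.mem_lowerTerms (hf : h.HasLeadingTerm P f a α)
    (hαβ : degLexKey α < degLexKey β) : f ∈ h.lowerTerms P β := by
  rw [← sub_add_cancel f (a • monomial x α)]
  exact add_mem (coeffSubmodule_mono le_rfl (fun _ hγ => hαβ.le.trans hγ) hf)
    (Submodule.smul_mem _ _ (monomial_mem_coeffSubmodule hαβ.not_ge))

theorem exists_hasLeadingTerm (hf : ∃ α, h.basis.repr f α ∉ P) :
    ∃ α, ∃ a ∉ P, h.HasLeadingTerm P f a α := by
  classical
  have hmem {γ} (hγ : h.basis.repr f γ ∉ P) : γ ∈ (h.basis.repr f).support :=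
    Finsupp.mem_support_iff.2 fun h0 => hγ (h0 ▸ P.zero_mem)
  obtain ⟨α, hα, hmax⟩ := Finset.exists_max_image
    ((h.basis.repr f).support.filter fun γ => h.basis.repr f γ ∉ P) degLexKey
    (hf.imp fun γ hγ => Finset.mem_filter.2 ⟨hmem hγ, hγ⟩)
  refine ⟨α, h.basis.repr f α, (Finset.mem_filter.1 hα).2, fun γ hγ => ?_⟩
  obtain rfl | hγα := eq_or_ne γ α
  · simp [h.repr_monomial]
  · have hγP : h.basis.repr f γ ∈ P := by
      by_contra hn
      have hle := hmax γ (Finset.mem_filter.2 ⟨hmem hn, hn⟩)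
      exact hγα (degLexKey_injective (le_antisymm hle hγ))
    simpa [h.repr_monomial, hγα] using hγP

theorem exists_hasLeadingTerm_var_mul_monomial (P : TwoSidedIdeal R) (i : Fin n)
    (α : Fin n → ℕ) : ∃ u u' : R, u' * u = 1 ∧
      h.HasLeadingTerm P (x i * monomial x α) u (α + Pi.single i 1) := by
  obtain ⟨u, u', hu, hlow⟩ := h.exists_var_mul_monomial i α
  exact ⟨u, u', hu, degLE_le_lowerTerms (by simp [Finset.sum_add_distrib]) hlow⟩

theorem HasLeadingTerm.var_mul (hP : h.IsInvariant P) (hf : h.HasLeadingTerm P f a α)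
    (i : Fin n) : ∃ u u' : R, u' * u = 1 ∧
      h.HasLeadingTerm P (x i * f) (h.sigma i a * u) (α + Pi.single i 1) := by
  have lt_add_single {γ : Fin n → ℕ} : degLexKey γ < degLexKey (γ + Pi.single i 1) :=
    lt_of_not_ge fun hle => by
      simpa [Finset.sum_add_distrib] using sum_le_of_degLexKey_le hle
  obtain ⟨u, u', hu, hlead⟩ := exists_hasLeadingTerm_var_mul_monomial (h := h) P i α
  refine ⟨u, u', hu, ?_⟩
  have hexpand : x i * f - (h.sigma i a * u) • monomial x (α + Pi.single i 1) =
      x i * (f - a • monomial x α) +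
        h.sigma i a • (x i * monomial x α - u • monomial x (α + Pi.single i 1)) +
        h.delta i a • monomial x α := by
    rw [mul_sub, h.var_mul_smul, smul_sub, mul_smul]
    abel
  rw [HasLeadingTerm, hexpand]
  refine add_mem (add_mem ?_ (Submodule.smul_mem _ _ hlead)) (Submodule.smul_mem _ _ ?_)
  · refine hP.var_mul_mem_coeffSubmodule (fun γ hγ => lt_add_single.le.trans hγ)
      (fun γ hγ => ?_) hf
    obtain ⟨v, -, -, hγlead⟩ := exists_hasLeadingTerm_var_mul_monomial (h := h) P i γ
    refine hγlead.mem_lowerTerms ?_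
    rw [degLexKey_add, degLexKey_add]
    exact add_lt_add_left (not_le.1 hγ) _
  · exact monomial_mem_coeffSubmodule lt_add_single.not_ge

theorem HasLeadingTerm.monomial_mul (hPc : IsCompletelyPrime P) (hP : h.IsInvariant P)
    (hf : h.HasLeadingTerm P f a β) (ha : a ∉ P) (α : Fin n → ℕ) :
    ∃ b ∉ P, h.HasLeadingTerm P (monomial x α * f) b (α + β) := by
  induction α using exponent_induction with
  | zero => exact ⟨a, ha, by simpa [monomial_zero] using hf⟩
  | add_single j γ hγ ih =>
    obtain ⟨b, hb, hlead⟩ := ih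
    obtain ⟨u, u', hu, hvar⟩ := hlead.var_mul hP j
    have huP : u ∉ P := fun huP => hPc.one_notMem (hu ▸ P.mul_mem_left u' u huP)
    refine ⟨h.sigma j b * u, hPc.mul_notMem (mt (hP.sigma_mem_iff j b).1 hb) huP, ?_⟩
    rwa [← var_mul_monomial x hγ, mul_assoc, add_right_comm]

theorem HasLeadingTerm.mul (hPc : IsCompletelyPrime P) (hP : h.IsInvariant P)
    (hf : h.HasLeadingTerm P f a α) (hg : h.HasLeadingTerm P g b β) (ha : a ∉ P) (hb : b ∉ P) :
    ∃ c ∉ P, h.HasLeadingTerm P (f * g) c (α + β) := by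
  obtain ⟨c, hc, hlead⟩ := hg.monomial_mul hPc hP hb α
  refine ⟨a * c, hPc.mul_notMem ha hc, ?_⟩
  have hexpand : f * g - (a * c) • monomial x (α + β) =
      (f - a • monomial x α) * g + a • (monomial x α * g - c • monomial x (α + β)) := by
    rw [sub_mul, smul_sub, smul_mul_assoc, mul_smul]
    abel
  rw [HasLeadingTerm, hexpand]
  refine add_mem (mul_mem_coeffSubmodule hf fun γ hγ => ?_) (Submodule.smul_mem _ _ hlead)
  obtain ⟨d, -, hγlead⟩ := hg.monomial_mul hPc hP hb γ
  refine hγlead.mem_lowerTerms ?_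
  rw [degLexKey_add, degLexKey_add]
  exact add_lt_add_left (not_le.1 hγ) _

theorem IsInvariant.isCompletelyPrime_extend (hP : h.IsInvariant P) (hPc : IsCompletelyPrime P) :
    IsCompletelyPrime hP.extend where
  one_notMem h1 := hPc.one_notMem (hP.coe_mem_extend_iff.1 (by simpa using h1))
  mem_or_mem f g hfg := by
    by_contra! hn
    simp only [hP.mem_extend, not_forall] at hn
    obtain ⟨α, a, ha, hf⟩ := exists_hasLeadingTerm hn.1
    obtain ⟨β, b, hb, hg⟩ := exists_hasLeadingTerm hn.2
    obtain ⟨c, hc, hlead⟩ := hf.mul hPc hP hg ha hb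
    exact hlead.repr_notMem hc (hP.mem_extend.1 hfg _)

end LeadingTerm

end IsSkewPBW

section Diameter

variable {S : Type*} [Ring S] {u v : {a : S // a ∈ nilZeroDivisors S ∧ a ≠ 0}}
  {I J : TwoSidedIdeal S}

theorem edist_nilpotentGraph_le_one (huv : IsNilpotent (u.1 * v.1)) :
    (nilpotentGraph S).edist u v ≤ 1 :=
  SimpleGraph.edist_le_one_iff_adj_or_eq.2 (or_iff_not_imp_right.2 fun hne => ⟨hne, huv⟩)

theorem edist_nilpotentGraph_le_two {b : S} (hb : b ≠ 0) (hub : IsNilpotent (u.1 * b))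
    (hbv : IsNilpotent (b * v.1)) : (nilpotentGraph S).edist u v ≤ 2 := by
  let w : {a : S // a ∈ nilZeroDivisors S ∧ a ≠ 0} := ⟨b, ⟨v.1, v.2.2, hbv⟩, hb⟩
  calc (nilpotentGraph S).edist u v
      ≤ (nilpotentGraph S).edist u w + (nilpotentGraph S).edist w v := SimpleGraph.edist_triangle
    _ ≤ 1 + 1 := add_le_add (edist_nilpotentGraph_le_one hub) (edist_nilpotentGraph_le_one hbv)
    _ = 2 := one_add_one_eq_two

theorem two_le_edist_nilpotentGraph (hne : u ≠ v) (huv : ¬IsNilpotent (u.1 * v.1)) :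
    2 ≤ (nilpotentGraph S).edist u v := by
  have hlt : 1 < (nilpotentGraph S).edist u v := by
    rw [← not_le, SimpleGraph.edist_le_one_iff_adj_or_eq]
    exact fun h => h.elim (fun hadj => huv hadj.2) hne
  simpa only [one_add_one_eq_two] using Order.add_one_le_of_lt hlt

theorem mem_or_mem_of_mem_nilZeroDivisors (hI : IsCompletelyPrime I) (hJ : IsCompletelyPrime J)
    (hIJ : ∀ b, b ∈ I → b ∈ J → b = 0) {a : S} (ha : a ∈ nilZeroDivisors S) : a ∈ I ∨ a ∈ J := by
  obtain ⟨b, hb, hab⟩ := ha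
  by_contra! hn
  exact hb (hIJ b ((hI.mem_or_mem a b (hI.mem_of_isNilpotent hab)).resolve_left hn.1)
    ((hJ.mem_or_mem a b (hJ.mem_of_isNilpotent hab)).resolve_left hn.2))

theorem ediam_nilpotentGraph_le_two (hI : IsCompletelyPrime I) (hJ : IsCompletelyPrime J)
    (hnil : ∀ a, a ∈ I → a ∈ J → IsNilpotent a) {p q : S} (hpI : p ∈ I) (hpJ : p ∉ J)
    (hqJ : q ∈ J) (hqI : q ∉ I) : (nilpotentGraph S).ediam ≤ 2 := by
  refine SimpleGraph.ediam_le_of_edist_le fun u v => ?_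
  by_cases hIJ : ∃ b, b ∈ I ∧ b ∈ J ∧ b ≠ 0
  · obtain ⟨b, hbI, hbJ, hb⟩ := hIJ
    exact edist_nilpotentGraph_le_two hb
      (hnil _ (I.mul_mem_left _ _ hbI) (J.mul_mem_left _ _ hbJ))
      (hnil _ (I.mul_mem_right _ _ hbI) (J.mul_mem_right _ _ hbJ))
  push Not at hIJ
  have isNilpotent_mul {a b : S} (ha : a ∈ I) (hb : b ∈ J) : IsNilpotent (a * b) :=
    hnil _ (I.mul_mem_right _ _ ha) (J.mul_mem_left _ _ hb)
  have hp : p ≠ 0 := fun hp => hpJ (hp ▸ J.zero_mem)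
  have hq : q ≠ 0 := fun hq => hqI (hq ▸ I.zero_mem)
  obtain hu | hu := mem_or_mem_of_mem_nilZeroDivisors hI hJ hIJ u.2.1 <;>
    obtain hv | hv := mem_or_mem_of_mem_nilZeroDivisors hI hJ hIJ v.2.1
  · exact edist_nilpotentGraph_le_two hq (isNilpotent_mul hu hqJ)
      (isNilpotent_mul_swap (isNilpotent_mul hv hqJ))
  · exact (edist_nilpotentGraph_le_one (isNilpotent_mul hu hv)).trans one_le_two
  · exact (edist_nilpotentGraph_le_one (isNilpotent_mul_swap (isNilpotent_mul hv hu))).trans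
      one_le_two
  · exact edist_nilpotentGraph_le_two hp (isNilpotent_mul_swap (isNilpotent_mul hpI hu))
      (isNilpotent_mul hpI hv)

/- Distinct elements of `I` outside `J` have a non-nilpotent product, as `J` is completely prime,
but both are adjacent to every element of `J` outside `I`. -/
theorem ediam_nilpotentGraph_eq_two (hI : IsCompletelyPrime I) (hJ : IsCompletelyPrime J)
    (hnil : ∀ a, a ∈ I → a ∈ J → IsNilpotent a) {p r q : S} (hpI : p ∈ I) (hpJ : p ∉ J)
    (hrI : r ∈ I) (hrJ : r ∉ J) (hpr : p ≠ r) (hqJ : q ∈ J) (hqI : q ∉ I) :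
    (nilpotentGraph S).ediam = 2 := by
  refine le_antisymm (ediam_nilpotentGraph_le_two hI hJ hnil hpI hpJ hqJ hqI) ?_
  have isVertex {a : S} (haI : a ∈ I) (haJ : a ∉ J) : a ∈ nilZeroDivisors S ∧ a ≠ 0 :=
    ⟨⟨q, fun hq => hqI (hq ▸ I.zero_mem), hnil _ (I.mul_mem_right _ _ haI)
      (J.mul_mem_left _ _ hqJ)⟩, fun ha => haJ (ha ▸ J.zero_mem)⟩
  calc 2 ≤ (nilpotentGraph S).edist ⟨p, isVertex hpI hpJ⟩ ⟨r, isVertex hrI hrJ⟩ :=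
        two_le_edist_nilpotentGraph (fun h => hpr (congrArg Subtype.val h))
          fun h => hJ.mul_notMem hpJ hrJ (hJ.mem_of_isNilpotent h)
    _ ≤ (nilpotentGraph S).ediam := SimpleGraph.edist_le_ediam

end Diameter

end SkewPBW

theorem mainTheorem1 {A : Type*} [Ring A] (R : Subring A) {n : ℕ} (hn : 0 < n)
    (x : Fin n → A) (hA : SkewPBW.IsSkewPBW R x)
    (hcompat : SkewPBW.IsCompatible hA.sigma hA.delta)
    (hprimal : SkewPBW.IsTwoPrimal R)
    (hmin : (SkewPBW.minimalPrimeIdeals R).encard = 2) :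
    (SkewPBW.nilpotentGraph A).ediam = 2 := by
  obtain ⟨P, Q, hne, hset⟩ := Set.encard_eq_two.1 hmin
  have hPmin : P ∈ SkewPBW.minimalPrimeIdeals R := by simp [hset]
  have hQmin : Q ∈ SkewPBW.minimalPrimeIdeals R := by simp [hset]
  have hPQ (a) (haP : a ∈ P) (haQ : a ∈ Q) : IsNilpotent a :=
    SkewPBW.isNilpotent_of_mem_primeRadical <|
      SkewPBW.mem_primeRadical_iff_forall_mem_minimalPrimeIdeals.2 (by simp [hset, haP, haQ])
  obtain ⟨p, hpP, hpQ⟩ := SkewPBW.exists_mem_notMem_of_mem_minimalPrimeIdeals hPmin hQmin hne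
  obtain ⟨q, hqQ, hqP⟩ := SkewPBW.exists_mem_notMem_of_mem_minimalPrimeIdeals hQmin hPmin hne.symm
  have hPq := hPmin.1.mem_iff_isNilpotent_mul hprimal hPQ hqQ hqP
  have hQp := hQmin.1.mem_iff_isNilpotent_mul hprimal (fun a haQ haP => hPQ a haP haQ) hpP hpQ
  have hP := SkewPBW.IsSkewPBW.isInvariant_of_mem_iff_isNilpotent_mul hcompat hPq
  have hQ := SkewPBW.IsSkewPBW.isInvariant_of_mem_iff_isNilpotent_mul hcompat hQp
  have hpx : (p : A) ≠ p * SkewPBW.monomial x (Pi.single ⟨0, hn⟩ 1) :=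
    SkewPBW.IsSkewPBW.coe_ne_coe_mul_monomial hA (by rintro rfl; exact hpQ Q.zero_mem) (by simp)
  exact SkewPBW.ediam_nilpotentGraph_eq_two
    (hP.isCompletelyPrime_extend (hPmin.1.isCompletelyPrime_of_mem_iff hprimal hPq))
    (hQ.isCompletelyPrime_extend (hQmin.1.isCompletelyPrime_of_mem_iff hprimal hQp))
    (fun f hfP hfQ => SkewPBW.IsSkewPBW.isNilpotent_of_forall_isNilpotent_repr hcompat hprimal
      fun α => hPQ _ (hP.mem_extend.1 hfP α) (hQ.mem_extend.1 hfQ α))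
    (hP.coe_mem_extend_iff.2 hpP) (mt hQ.coe_mem_extend_iff.1 hpQ)
    ((hP.coe_mul_monomial_mem_extend_iff _).2 hpP)
    (mt (hQ.coe_mul_monomial_mem_extend_iff _).1 hpQ) hpx
    (hQ.coe_mem_extend_iff.2 hqQ) (mt hP.coe_mem_extend_iff.1 hqP)
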